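/- An effect algebra is a set $E$ with distinct elements $0,1$ and a partial operation $\oplus$ such that: $x\oplus y=y\oplus x$ whenever $x\oplus y$ is defined; $(x\oplus y)\oplus z=x\oplus(y\oplus z)$ whenever one side is defined; for every $x\in E$ there is a unique $x'\in E$ with $x\oplus x'=1$; and if $1\oplus x$ is defined, then $x=0$. It is ordered by $x\le y$ iff $x\oplus z=y$ for some $z\in E$. It is a modular lattice effect algebra if this order is a modular lattice. It is Archimedean if for every $x\neq 0$ the multiple $nx=x\oplus\cdots\oplus x$ ($n$ times) fails to exist for some positive integer $n$. An atom is a minimal nonzero element. An element is finite if it is $0$ or of the form $a_1\oplus\cdots\oplus a_n$ with (not necessarily distinct) atoms $a_1,\dots,a_n$. An element $x$ is sharp if $x\wedge x'=0$. A subset $Q\subseteq E$ is a sub-lattice effect algebra of $E$ if $0,1\in Q$, $Q$ is closed under $x\mapsto x'$, $\vee$ and $\wedge$, and $x\oplus y\in Q$ whenever $x,y\in Q$ and $x\oplus y$ is defined; $Q$ is then an effect algebra with the inherited operations. An effect algebra is sharply dominating if for every element $a$ there is a smallest sharp element $b$ with $a\le b$. **Theorem.** Let $E$ be a modular Archimedean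 lattice effect algebra and let $E_1=\{x\in E \mid x \text{ is finite or } x' \text{ is finite}\}$. Then: 1. $E_1$ is a sub-lattice effect algebra of $E$. 2. For every finite $x\in E$ there exist a smallest sharp element of $E$ above $x$ (that is, $\ge x$) and a greatest sharp element of $E$ below $x$ (that is, $\le x$). 3. The effect algebra $E_1$ is sharply dominating. -/

import Mathlib

/-- An effect algebra: a set with two distinct elements `0`, `1` and a partial binary operation
`oplus` (with `oplus x y = none` meaning that `x ⊕ y` is not defined). -/
class EffectAlgebra (E : Type*) extends Zero E, One E where
  /-- The partial sum. -/
  oplus : E → E → Option E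
  zero_ne_one : (0 : E) ≠ 1
  oplus_comm : ∀ x y : E, oplus x y = oplus y x
  /-- If one of `(x ⊕ y) ⊕ z`, `x ⊕ (y ⊕ z)` is defined then so is the other, and they agree. -/
  oplus_assoc : ∀ x y z : E,
    ((oplus x y).bind fun s => oplus s z) = ((oplus y z).bind fun s => oplus x s)
  exists_unique_compl : ∀ x : E, ∃! y : E, oplus x y = some 1
  eq_zero_of_one_oplus : ∀ x : E, (oplus 1 x).isSome → x = 0

namespace EffectAlgebra

section Basic

variable {E : Type*} [EffectAlgebra E]

/-- The orthosupplement `x'`, the unique `y` with `x ⊕ y = 1`. -/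
noncomputable def compl (x : E) : E := (exists_unique_compl x).choose

theorem oplus_compl (x : E) : oplus x (compl x) = some 1 :=
  (exists_unique_compl x).choose_spec.1

theorem eq_compl {x y : E} (h : oplus x y = some 1) : y = compl x :=
  (exists_unique_compl x).choose_spec.2 y h

theorem compl_compl (x : E) : compl (compl x) = x :=
  (eq_compl ((oplus_comm _ _).trans (oplus_compl x))).symm

/-- Reassociate to the right. -/
theorem assoc_right {x y z s t : E} (h : oplus x y = some s) (h' : oplus s z = some t) :
    ∃ u, oplus y z = some u ∧ oplus x u = some t := by
  have := oplus_assoc x y z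
  rw [h, Option.bind_some, h'] at this
  exact Option.bind_eq_some_iff.1 this.symm

/-- Reassociate to the left. -/
theorem assoc_left {x y z u t : E} (h : oplus y z = some u) (h' : oplus x u = some t) :
    ∃ s, oplus x y = some s ∧ oplus s z = some t := by
  have := oplus_assoc x y z
  rw [h, Option.bind_some, h'] at this
  exact Option.bind_eq_some_iff.1 this

theorem one_oplus_zero : oplus (1 : E) 0 = some 1 := by
  have h := oplus_compl (1 : E)
  rwa [eq_zero_of_one_oplus (compl (1 : E)) (by rw [h]; rfl)] at h

theorem oplus_zero (x : E) : oplus x 0 = some x := by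
  obtain ⟨w, hw, hw'⟩ := assoc_right ((oplus_comm _ _).trans (oplus_compl x)) one_oplus_zero
  rwa [eq_compl hw', compl_compl] at hw

theorem oplus_left_cancel {x y z w : E} (h : oplus x y = some w) (h' : oplus x z = some w) :
    y = z := by
  have aux : ∀ {a : E}, oplus x a = some w → ∃ t, oplus x (compl w) = some t ∧ a = compl t := by
    intro a ha
    obtain ⟨t, ht, hat⟩ := assoc_right ((oplus_comm _ _).trans ha) (oplus_compl w)
    exact ⟨t, ht, eq_compl ((oplus_comm _ _).trans hat)⟩
  obtain ⟨t, ht, rfl⟩ := aux h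
  obtain ⟨s, hs, rfl⟩ := aux h'
  rw [Option.some.inj (ht.symm.trans hs)]

theorem eq_zero_of_oplus_eq_zero {a b : E} (h : oplus a b = some 0) : a = 0 := by
  obtain ⟨s, hs, -⟩ := assoc_left h (one_oplus_zero (E := E))
  exact eq_zero_of_one_oplus a (by rw [hs]; rfl)

/-- The order of an effect algebra: `x ≤ y` iff `x ⊕ z = y` for some `z`. -/
instance instPartialOrder : PartialOrder E where
  le x y := ∃ z, oplus x z = some y
  le_refl x := ⟨0, oplus_zero x⟩
  le_trans := by
    rintro x y z ⟨a, ha⟩ ⟨b, hb⟩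
    obtain ⟨u, -, hu⟩ := assoc_right ha hb
    exact ⟨u, hu⟩
  le_antisymm := by
    rintro x y ⟨a, ha⟩ ⟨b, hb⟩
    obtain ⟨u, hu, hxu⟩ := assoc_right ha hb
    obtain rfl := oplus_left_cancel hxu (oplus_zero x)
    obtain rfl := eq_zero_of_oplus_eq_zero hu
    exact Option.some.inj ((oplus_zero x).symm.trans ha)

theorem le_def {x y : E} : x ≤ y ↔ ∃ z, oplus x z = some y := Iff.rfl

/-- `0` is the least and `1` is the greatest element. -/
instance instBoundedOrder : BoundedOrder E where
  bot := 0
  bot_le x := ⟨x, (oplus_comm _ _).trans (oplus_zero x)⟩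
  top := 1
  le_top x := ⟨compl x, oplus_compl x⟩

/-- The sum `((x₁ ⊕ x₂) ⊕ ⋯) ⊕ xₙ` of a finite sequence, if it is defined; the empty sum is `0`. -/
def osum (l : List E) : Option E := l.foldlM oplus 0

/-- The finite elements: (possibly empty) sums of finite sequences of not necessarily
different atoms. -/
def IsFiniteElement (u : E) : Prop :=
  ∃ l : List E, (∀ a ∈ l, IsAtom a) ∧ osum l = some u

/-- `ord x = ∞`: the multiple `n x = x ⊕ ⋯ ⊕ x` exists for all positive integers `n`. -/
def HasInfiniteOrder (x : E) : Prop :=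
  ∀ n : ℕ, 0 < n → (osum (List.replicate n x)).isSome

/-- An element is sharp if the infimum `x ∧ x'` exists and equals `0`. -/
def IsSharp (x : E) : Prop := IsGLB {x, compl x} (0 : E)

variable (E) in
/-- Every nonzero element has finite order. -/
def IsArchimedean : Prop := ∀ x : E, x ≠ 0 → ¬ HasInfiniteOrder x

variable (E) in
/-- Above every element there is a smallest sharp element. -/
def IsSharplyDominating : Prop :=
  ∀ a : E, ∃ s : E, IsLeast {b : E | IsSharp b ∧ a ≤ b} s

variable (E) in
/-- The set of all elements `x` such that `x` is finite or `x'` is finite. -/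
def finiteOrCofinite : Set E := {x | IsFiniteElement x ∨ IsFiniteElement (compl x)}

/-- Sub-effect algebras. -/
structure IsSubEffectAlgebra (Q : Set E) : Prop where
  zero_mem : 0 ∈ Q
  one_mem : 1 ∈ Q
  compl_mem : ∀ {x}, x ∈ Q → compl x ∈ Q
  oplus_mem : ∀ {x y z}, x ∈ Q → y ∈ Q → oplus x y = some z → z ∈ Q

/-- The inherited partial operation of a sub-effect algebra. -/
def IsSubEffectAlgebra.subOplus {Q : Set E} (h : IsSubEffectAlgebra Q) (x y : Q) : Option Q :=
  (oplus (x : E) (y : E)).pmap (fun z hz => ⟨z, hz⟩)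
    (fun _ hz => h.oplus_mem x.2 y.2 hz)

theorem IsSubEffectAlgebra.subOplus_eq_some {Q : Set E} (h : IsSubEffectAlgebra Q) {x y z : Q} :
    h.subOplus x y = some z ↔ oplus (x : E) (y : E) = some (z : E) := by
  constructor
  · intro e
    obtain ⟨a, ha, hz, e'⟩ := Option.pmap_eq_some_iff.1 e
    rw [hz, e']
  · intro e
    exact Option.pmap_eq_some_iff.2 ⟨z, z.2, e, rfl⟩

/-- A sub-effect algebra with the inherited operation is an effect algebra in its own right. -/
@[reducible]
def IsSubEffectAlgebra.toEffectAlgebra {Q : Set E} (h : IsSubEffectAlgebra Q) :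
    EffectAlgebra Q where
  zero := ⟨0, h.zero_mem⟩
  one := ⟨1, h.one_mem⟩
  oplus := h.subOplus
  zero_ne_one e := zero_ne_one (E := E) (congrArg Subtype.val e)
  oplus_comm x y := by
    ext z
    rw [h.subOplus_eq_some, h.subOplus_eq_some, oplus_comm]
  oplus_assoc x y z := by
    ext t
    rw [Option.bind_eq_some_iff, Option.bind_eq_some_iff]
    constructor
    · rintro ⟨s, hs, ht⟩
      obtain ⟨u, hu, hu'⟩ := assoc_right (h.subOplus_eq_some.1 hs) (h.subOplus_eq_some.1 ht)
      exact ⟨⟨u, h.oplus_mem y.2 z.2 hu⟩, h.subOplus_eq_some.2 hu, h.subOplus_eq_some.2 hu'⟩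
    · rintro ⟨s, hs, ht⟩
      obtain ⟨u, hu, hu'⟩ := assoc_left (h.subOplus_eq_some.1 hs) (h.subOplus_eq_some.1 ht)
      exact ⟨⟨u, h.oplus_mem x.2 y.2 hu⟩, h.subOplus_eq_some.2 hu, h.subOplus_eq_some.2 hu'⟩
  exists_unique_compl x :=
    ⟨⟨compl (x : E), h.compl_mem x.2⟩, h.subOplus_eq_some.2 (oplus_compl (x : E)),
      fun _ hy => Subtype.ext (eq_compl (h.subOplus_eq_some.1 hy))⟩
  eq_zero_of_one_oplus x hx := by
    obtain ⟨w, hw⟩ := Option.isSome_iff_exists.1 hx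
    exact Subtype.ext (eq_zero_of_one_oplus (x : E)
      (Option.isSome_iff_exists.2 ⟨w, h.subOplus_eq_some.1 hw⟩))

end Basic

end EffectAlgebra

/-- A lattice effect algebra: any two elements have a supremum and an infimum in the order of
the effect algebra. -/
class LatticeEffectAlgebra (E : Type*) extends EffectAlgebra E where
  sup : E → E → E
  inf : E → E → E
  isLUB_sup : ∀ x y : E, IsLUB {x, y} (sup x y)
  isGLB_inf : ∀ x y : E, IsGLB {x, y} (inf x y)

namespace LatticeEffectAlgebra

variable {E : Type*} [LatticeEffectAlgebra E]

instance instLattice : Lattice E where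
  __ := EffectAlgebra.instPartialOrder (E := E)
  sup := sup
  inf := inf
  le_sup_left x y := (isLUB_sup x y).1 (Set.mem_insert _ _)
  le_sup_right x y := (isLUB_sup x y).1 (Set.mem_insert_of_mem _ rfl)
  sup_le x y _ hx hy := (isLUB_sup x y).2 (by rintro w (rfl | rfl) <;> assumption)
  inf_le_left x y := (isGLB_inf x y).1 (Set.mem_insert _ _)
  inf_le_right x y := (isGLB_inf x y).1 (Set.mem_insert_of_mem _ rfl)
  le_inf _ x y hx hy := (isGLB_inf x y).2 (by rintro w (rfl | rfl) <;> assumption)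

/-- Sub-lattice effect algebras: sub-effect algebras that are sublattices. -/
structure IsSubLatticeEffectAlgebra (Q : Set E) : Prop
    extends EffectAlgebra.IsSubEffectAlgebra Q where
  sup_mem : ∀ {x y}, x ∈ Q → y ∈ Q → x ⊔ y ∈ Q
  inf_mem : ∀ {x y}, x ∈ Q → y ∈ Q → x ⊓ y ∈ Q

end LatticeEffectAlgebra

/-! Adding an atom is the same as going up a cover, so sums of atoms are ends of finite chains of
covers. Modularity transports covers through meets and joins: finite elements form an ideal closed
under `⊕`, with a strictly decreasing length bound (`IsAtomSum.of_le`). This makes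
finite-or-cofinite elements a subalgebra.

Modularity also makes sharp elements principal, so they are closed under `⊓` and `⊔`. The largest
multiple of an atom is sharp, hence every finite element lies below a finite sharp one. Minimising
length then gives the least sharp element above, and minimising the length of the remainder gives
the greatest sharp element below. Complements handle the cofinite case. -/

namespace EffectAlgebra

/-! ### Order, covers and sums of atoms -/

section Order

variable {E : Type*} [EffectAlgebra E] {x y z s t a : E}

theorem zero_oplus (x : E) : oplus 0 x = some x := (oplus_comm _ _).trans (oplus_zero x)

theorem zero_le (x : E) : 0 ≤ x := ⟨x, zero_oplus x⟩

theorem eq_zero_of_le_zero (h : x ≤ 0) : x = 0 := le_antisymm h (zero_le x)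

theorem left_le_of_oplus (h : oplus x y = some z) : x ≤ z := ⟨y, h⟩

theorem right_le_of_oplus (h : oplus x y = some z) : y ≤ z := ⟨x, (oplus_comm _ _).trans h⟩

theorem le_of_oplus_le_oplus (hs : oplus x y = some s) (ht : oplus x z = some t) (h : s ≤ t) :
    y ≤ z := by
  obtain ⟨w, hw⟩ := h
  obtain ⟨u, hu, hxu⟩ := assoc_right hs hw
  obtain rfl := oplus_left_cancel hxu ht
  exact ⟨w, hu⟩

/-- If `x ⊕ z` is defined and `y ≤ z`, then `x ⊕ y` is defined and `x ⊕ y ≤ x ⊕ z`. -/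
theorem exists_oplus_of_le (ht : oplus x z = some t) (h : y ≤ z) :
    ∃ s, oplus x y = some s ∧ s ≤ t := by
  obtain ⟨w, hw⟩ := h
  obtain ⟨s, hs, hst⟩ := assoc_left hw ht
  exact ⟨s, hs, w, hst⟩

theorem exists_oplus_iff_le_compl : (∃ s, oplus x y = some s) ↔ y ≤ compl x := by
  constructor
  · rintro ⟨s, hs⟩
    obtain ⟨u, hu, hxu⟩ := assoc_right hs (oplus_compl s)
    rw [← eq_compl hxu]
    exact ⟨_, hu⟩
  · intro h
    obtain ⟨s, hs, -⟩ := exists_oplus_of_le (oplus_compl x) h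
    exact ⟨s, hs⟩

theorem le_compl_comm : x ≤ compl y ↔ y ≤ compl x := by
  rw [← exists_oplus_iff_le_compl, ← exists_oplus_iff_le_compl, oplus_comm]

theorem compl_le_compl_iff : compl x ≤ compl y ↔ y ≤ x := by
  rw [le_compl_comm, compl_compl]

theorem compl_le_iff : compl x ≤ y ↔ compl y ≤ x := by
  rw [← compl_le_compl_iff, compl_compl]

/-- Differences are antitone in the subtracted element. -/
theorem sub_antitone (hz : oplus x z = some t) (hs : oplus y s = some t) (h : x ≤ y) : s ≤ z := by
  obtain ⟨w, hw⟩ := h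
  obtain ⟨u, hu, hxu⟩ := assoc_right hw hs
  obtain rfl := oplus_left_cancel hxu hz
  exact right_le_of_oplus hu

theorem covBy_of_oplus_isAtom (h : oplus x a = some y) (ha : IsAtom a) : x ⋖ y := by
  refine ⟨lt_of_le_of_ne ⟨a, h⟩ ?_, ?_⟩
  · rintro rfl
    exact ha.1 (oplus_left_cancel h (oplus_zero x))
  · rintro c hxc hcy
    obtain ⟨w, hw⟩ := hxc.le
    have hwa : w ≤ a := le_of_oplus_le_oplus hw h hcy.le
    rcases ha.le_iff.1 hwa with rfl | rfl
    · exact hxc.ne (Option.some.inj ((oplus_zero x).symm.trans hw))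
    · exact hcy.ne (Option.some.inj (hw.symm.trans h))

theorem exists_isAtom_of_covBy (h : x ⋖ y) : ∃ a, IsAtom a ∧ oplus x a = some y := by
  obtain ⟨a, ha⟩ := h.le
  refine ⟨a, ⟨?_, fun b hb => ?_⟩, ha⟩
  · rintro rfl
    exact h.ne (Option.some.inj ((oplus_zero x).symm.trans ha))
  · obtain ⟨c, hc, hcy⟩ := exists_oplus_of_le ha hb.le
    rcases h.eq_or_eq ⟨b, hc⟩ hcy with rfl | rfl
    · exact oplus_left_cancel hc (oplus_zero _)
    · exact absurd (oplus_left_cancel hc ha) hb.ne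

theorem isSharp_iff : IsSharp x ↔ ∀ c, c ≤ x → c ≤ compl x → c = 0 := by
  constructor
  · intro h c h₁ h₂
    refine eq_zero_of_le_zero (h.2 ?_)
    rintro w (rfl | rfl) <;> assumption
  · intro h
    refine ⟨fun w _ => zero_le w, fun c hc => ?_⟩
    rw [h c (hc (Set.mem_insert _ _)) (hc (Set.mem_insert_of_mem _ rfl))]

theorem IsSharp.isSharp_compl (h : IsSharp x) : IsSharp (compl x) := by
  rw [isSharp_iff] at h ⊢
  intro c h₁ h₂
  rw [compl_compl] at h₂
  exact h c h₂ h₁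

theorem isSharp_zero : IsSharp (0 : E) :=
  isSharp_iff.2 fun _ h _ => eq_zero_of_le_zero h

/-- `x` is principal if it bounds the sum of any two elements below it. -/
def IsPrincipalElement (x : E) : Prop :=
  ∀ y z s : E, y ≤ x → z ≤ x → oplus y z = some s → s ≤ x

theorem IsPrincipalElement.isSharp (h : IsPrincipalElement x) : IsSharp x := by
  refine isSharp_iff.2 fun c hc hc' => ?_
  obtain ⟨s, hs⟩ := exists_oplus_iff_le_compl.2 hc'
  have : s = x := le_antisymm (h x c s le_rfl hc hs) ⟨c, hs⟩
  subst this
  exact oplus_left_cancel hs (oplus_zero s)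

/-- `x` is the sum of a sequence of `n` atoms. -/
inductive IsAtomSum : ℕ → E → Prop
  | zero : IsAtomSum 0 0
  | succ {n : ℕ} {x a y : E} :
    IsAtomSum n x → IsAtom a → oplus x a = some y → IsAtomSum (n + 1) y

theorem osum_append_singleton (l : List E) (a : E) :
    osum (l ++ [a]) = (osum l).bind fun s => oplus s a := by
  simp [osum, List.foldlM_append]

theorem IsAtomSum.isFiniteElement {n : ℕ} (h : IsAtomSum n x) : IsFiniteElement x := by
  induction h with
  | zero => exact ⟨[], by simp, rfl⟩
  | @succ n x a y _ ha hy ih =>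
    obtain ⟨l, hl, hx⟩ := ih
    refine ⟨l ++ [a], ?_, ?_⟩
    · intro b hb
      rcases List.mem_append.1 hb with hb | hb
      · exact hl b hb
      · rwa [List.mem_singleton.1 hb]
    · rw [osum_append_singleton, hx, Option.bind_some, hy]

theorem isFiniteElement_iff : IsFiniteElement x ↔ ∃ n, IsAtomSum n x := by
  refine ⟨?_, fun ⟨_, h⟩ => h.isFiniteElement⟩
  rintro ⟨l, hl, hx⟩
  induction l using List.reverseRecOn generalizing x with
  | nil =>
    obtain rfl : (0 : E) = x := Option.some.inj hx
    exact ⟨0, .zero⟩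
  | append_singleton l a ih =>
    rw [osum_append_singleton] at hx
    obtain ⟨s, hs, hsx⟩ := Option.bind_eq_some_iff.1 hx
    obtain ⟨n, hn⟩ := ih (fun b hb => hl b (List.mem_append_left _ hb)) hs
    exact ⟨n + 1, .succ hn (hl a (by simp)) hsx⟩

theorem isFiniteElement_zero : IsFiniteElement (0 : E) := IsAtomSum.zero.isFiniteElement

theorem IsAtomSum.succ_of_covBy {n : ℕ} (h : IsAtomSum n x) (hxy : x ⋖ y) :
    IsAtomSum (n + 1) y := by
  obtain ⟨a, ha, hy⟩ := exists_isAtom_of_covBy hxy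
  exact .succ h ha hy

theorem IsFiniteElement.oplus (hx : IsFiniteElement x) (hy : IsFiniteElement y)
    (h : oplus x y = some z) : IsFiniteElement z := by
  obtain ⟨n, hn⟩ := isFiniteElement_iff.1 hy
  induction hn generalizing z with
  | zero => rwa [← Option.some.inj ((oplus_zero x).symm.trans h)]
  | @succ n u a y hu ha huy ih =>
    obtain ⟨s, hs, hsz⟩ := assoc_left huy h
    obtain ⟨m, hm⟩ := isFiniteElement_iff.1 (ih hu.isFiniteElement hs)
    exact (IsAtomSum.succ hm ha hsz).isFiniteElement

end Order

/-! ### Disjoint sums and multiples of an atom -/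

section Lattice

variable {E : Type*} [LatticeEffectAlgebra E] {x y z s t a b : E}

/-- The remainder of `x ⊔ y` in `z` lies below both `y` and `x`, hence below their zero meet. -/
theorem sup_eq_of_oplus (h : oplus x y = some z) (hxy : x ⊓ y = 0) : x ⊔ y = z := by
  have hle : x ⊔ y ≤ z := sup_le (left_le_of_oplus h) (right_le_of_oplus h)
  obtain ⟨w, hw⟩ := hle
  have hwy : w ≤ y := sub_antitone h hw le_sup_left
  have hwx : w ≤ x := sub_antitone ((oplus_comm _ _).trans h) hw le_sup_right
  obtain rfl : w = 0 := eq_zero_of_le_zero (hxy ▸ le_inf hwx hwy)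
  exact Option.some.inj ((oplus_zero _).symm.trans hw)

theorem compl_inf (x y : E) : compl (x ⊓ y) = compl x ⊔ compl y := by
  apply le_antisymm
  · rw [compl_le_iff]
    exact le_inf (compl_le_iff.1 le_sup_left) (compl_le_iff.1 le_sup_right)
  · exact sup_le (compl_le_compl_iff.2 inf_le_left) (compl_le_compl_iff.2 inf_le_right)

theorem compl_sup (x y : E) : compl (x ⊔ y) = compl x ⊓ compl y := by
  rw [← compl_compl (compl x ⊓ compl y), compl_inf, compl_compl, compl_compl]

/-- If `b` is disjoint from `a` and `b ⊕ m a` exists, then `b` is disjoint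
from `m a`. -/
theorem inf_osum_replicate_eq_zero (hab : a ⊓ b = 0) {m : ℕ}
    (hs : osum (List.replicate m a) = some s) (hb : b ≤ compl s) : s ⊓ b = 0 := by
  induction m generalizing s with
  | zero =>
    obtain rfl : (0 : E) = s := Option.some.inj hs
    exact eq_zero_of_le_zero inf_le_left
  | succ m ih =>
    rw [List.replicate_succ', osum_append_singleton] at hs
    obtain ⟨u, hu, hus⟩ := Option.bind_eq_some_iff.1 hs
    have hbu : b ≤ compl u := hb.trans (compl_le_compl_iff.2 (left_le_of_oplus hus))
    obtain ⟨v, hv⟩ := exists_oplus_iff_le_compl.2 ((inf_le_right (a := s)).trans hbu)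
    have hdisj : u ⊓ (s ⊓ b) = 0 :=
      eq_zero_of_le_zero ((inf_le_inf_left u inf_le_right).trans (ih hu hbu).le)
    -- Disjointness turns `u ⊕ (s ⊓ b)` into a join, which lies below `s = u ⊕ a`; cancelling `u`
    -- gives `s ⊓ b ≤ a`.
    have hvs : v ≤ s := by
      rw [← sup_eq_of_oplus hv hdisj]
      exact sup_le (left_le_of_oplus hus) inf_le_left
    exact eq_zero_of_le_zero (hab ▸ le_inf (le_of_oplus_le_oplus hv hus hvs) inf_le_right)

/-- The largest existing multiple of an atom is sharp. -/
theorem isSharp_of_maximal_multiple (ha : IsAtom a) {m : ℕ}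
    (hs : osum (List.replicate m a) = some s) (hmax : oplus s a = none) : IsSharp s := by
  refine isSharp_iff.2 fun c hcs hcs' => ?_
  rcases ha.le_iff.1 (inf_le_left : a ⊓ c ≤ a) with h | h
  · rw [← inf_osum_replicate_eq_zero h hs hcs', inf_eq_right.2 hcs]
  · obtain ⟨t, ht⟩ := exists_oplus_iff_le_compl.2 ((inf_eq_left.1 h).trans hcs')
    rw [hmax] at ht
    cases ht

theorem exists_finite_isSharp_ge_of_isAtom (hArch : IsArchimedean E) (ha : IsAtom a) :
    ∃ s, IsFiniteElement s ∧ IsSharp s ∧ a ≤ s := by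
  classical
  have hex : ∃ n, osum (List.replicate n a) = none := by
    by_contra! h
    exact hArch a ha.1 fun n _ => Option.isSome_iff_ne_none.2 (h n)
  have hspec := Nat.find_spec hex
  have hmin := fun m => Nat.find_min hex (m := m)
  generalize Nat.find hex = n at hspec hmin
  -- The first undefined multiple is neither `0a` nor `1a`, so the last defined one is at least `a`.
  rcases n with _ | _ | m
  · cases hspec
  · have h0 : osum [a] = oplus 0 a := by simp [osum]
    rw [List.replicate_one, h0, zero_oplus] at hspec
    cases hspec
  · obtain ⟨s, hs⟩ := Option.ne_none_iff_exists'.1 (hmin (m + 1) (Nat.lt_succ_self _))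
    rw [List.replicate_succ', osum_append_singleton, hs, Option.bind_some] at hspec
    refine ⟨s, ⟨_, fun b hb => ?_, hs⟩, isSharp_of_maximal_multiple ha hs hspec, ?_⟩
    · rwa [List.eq_of_mem_replicate hb]
    · rw [List.replicate_succ', osum_append_singleton] at hs
      obtain ⟨u, -, hus⟩ := Option.bind_eq_some_iff.1 hs
      exact right_le_of_oplus hus

end Lattice

/-! ### Modularity: sharp and finite elements -/

section Modular

variable {E : Type*} [LatticeEffectAlgebra E] [IsModularLattice E] {x y z s t a b : E}

/-- Write `x = y ⊕ d`. Then `y' = d ⊕ x' = d ⊔ x'` since `d ⊓ x' = 0`, and the modular law gives `z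
≤ (d ⊔ x') ⊓ x = d`, so `y ⊕ z ≤ y ⊕ d = x`. -/
theorem IsSharp.isPrincipalElement (h : IsSharp x) : IsPrincipalElement x := by
  intro y z s hy hz hs
  obtain ⟨d, hd⟩ := hy
  obtain ⟨u, hu, hyu⟩ := assoc_right hd (oplus_compl x)
  obtain rfl := eq_compl hyu
  have hdx : d ≤ x := right_le_of_oplus hd
  have hdisj : d ⊓ compl x = 0 := isSharp_iff.1 h _ (inf_le_left.trans hdx) inf_le_right
  have hxx : compl x ⊓ x = 0 := isSharp_iff.1 h _ inf_le_right inf_le_left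
  have hzd : z ≤ d := by
    have hz' : z ≤ (d ⊔ compl x) ⊓ x := by
      rw [sup_eq_of_oplus hu hdisj]
      exact le_inf (exists_oplus_iff_le_compl.1 ⟨s, hs⟩) hz
    rw [sup_inf_assoc_of_le _ hdx, hxx] at hz'
    exact hz'.trans (sup_le le_rfl (zero_le d))
  obtain ⟨s', hs', hle⟩ := exists_oplus_of_le hd hzd
  obtain rfl := Option.some.inj (hs.symm.trans hs')
  exact hle

theorem IsSharp.inf (hx : IsSharp x) (hy : IsSharp y) : IsSharp (x ⊓ y) :=
  IsPrincipalElement.isSharp fun a b s ha hb hs =>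
    le_inf
      (hx.isPrincipalElement a b s (ha.trans inf_le_left) (hb.trans inf_le_left) hs)
      (hy.isPrincipalElement a b s (ha.trans inf_le_right) (hb.trans inf_le_right) hs)

theorem IsSharp.sup (hx : IsSharp x) (hy : IsSharp y) : IsSharp (x ⊔ y) := by
  have h := (hx.isSharp_compl.inf hy.isSharp_compl).isSharp_compl
  rwa [compl_inf, compl_compl, compl_compl] at h

/-- An element below a sum of `n` atoms is a sum of at most `n` atoms, and of fewer than `n`
atoms if it is strictly below. -/
theorem IsAtomSum.of_le {n : ℕ} (hx : IsAtomSum n x) (h : y ≤ x) :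
    ∃ m, m ≤ n ∧ IsAtomSum m y ∧ (m = n → y = x) := by
  induction hx generalizing y with
  | zero =>
    obtain rfl := eq_zero_of_le_zero h
    exact ⟨0, le_rfl, .zero, fun _ => rfl⟩
  | @succ n u a x hu ha hux ih =>
    have hcov : u ⋖ x := covBy_of_oplus_isAtom hux ha
    by_cases hyu : y ≤ u
    · obtain ⟨m, hm, hy, -⟩ := ih hyu
      exact ⟨m, hm.trans n.le_succ, hy, fun e => absurd e (by omega)⟩
    · have hsup : u ⊔ y = x := by
        rcases hcov.eq_or_eq le_sup_left (sup_le hcov.le h) with e | e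
        · exact absurd (sup_eq_left.1 e) hyu
        · exact e
      -- By modularity the cover `u ⋖ u ⊔ y` descends to `u ⊓ y ⋖ y`.
      have hcov' : u ⊓ y ⋖ y := inf_covBy_of_covBy_sup_left (by rwa [hsup])
      obtain ⟨m, hm, hy, he⟩ := ih (inf_le_left : u ⊓ y ≤ u)
      refine ⟨m + 1, Nat.succ_le_succ hm, hy.succ_of_covBy hcov', fun e => ?_⟩
      rw [← hsup, sup_eq_right.2 (inf_eq_left.1 (he (Nat.succ.inj e)))]

theorem IsFiniteElement.of_le (hx : IsFiniteElement x) (h : y ≤ x) : IsFiniteElement y := by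
  obtain ⟨n, hn⟩ := isFiniteElement_iff.1 hx
  obtain ⟨m, -, hm, -⟩ := hn.of_le h
  exact hm.isFiniteElement

theorem IsFiniteElement.sup (hx : IsFiniteElement x) (hy : IsFiniteElement y) :
    IsFiniteElement (x ⊔ y) := by
  obtain ⟨n, hn⟩ := isFiniteElement_iff.1 hy
  induction hn with
  | zero => rwa [sup_eq_left.2 (zero_le x)]
  | @succ n u a y hu ha huy ih =>
    have hcov : u ⋖ y := covBy_of_oplus_isAtom huy ha
    have hfin := ih hu.isFiniteElement
    have hsup : x ⊔ u ⊔ y = x ⊔ y := by rw [sup_assoc, sup_eq_right.2 hcov.le]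
    -- Adding one atom to `u` either raises the join by a single cover or leaves it unchanged.
    rcases hcov.eq_or_eq (le_inf le_sup_right hcov.le : u ≤ (x ⊔ u) ⊓ y) inf_le_right with h | h
    · have hc : x ⊔ u ⋖ x ⊔ u ⊔ y := covBy_sup_of_inf_covBy_right (by rwa [h])
      obtain ⟨m, hm⟩ := isFiniteElement_iff.1 hfin
      rw [hsup] at hc
      exact (hm.succ_of_covBy hc).isFiniteElement
    · rwa [← hsup, sup_eq_left.2 (inf_eq_right.1 h)]

theorem exists_finite_isSharp_ge (hArch : IsArchimedean E) (hx : IsFiniteElement x) :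
    ∃ s, IsFiniteElement s ∧ IsSharp s ∧ x ≤ s := by
  obtain ⟨n, hn⟩ := isFiniteElement_iff.1 hx
  induction hn with
  | zero => exact ⟨0, isFiniteElement_zero, isSharp_zero, le_rfl⟩
  | @succ n u a x hu ha hux ih =>
    obtain ⟨s, hsf, hss, hus⟩ := ih hu.isFiniteElement
    obtain ⟨t, htf, hts, hat⟩ := exists_finite_isSharp_ge_of_isAtom hArch ha
    exact ⟨s ⊔ t, hsf.sup htf, hss.sup hts, (hss.sup hts).isPrincipalElement u a x
      (hus.trans le_sup_left) (hat.trans le_sup_right) hux⟩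

/-- Take a sharp `s ≥ x` with the fewest atoms. Its meet with another sharp bound is again one and
cannot be shorter, so it equals `s`. -/
theorem exists_isLeast_isSharp_ge (hArch : IsArchimedean E) (hx : IsFiniteElement x) :
    ∃ s, IsFiniteElement s ∧ IsLeast {b | IsSharp b ∧ x ≤ b} s := by
  classical
  have hex : ∃ n, ∃ s, IsAtomSum n s ∧ IsSharp s ∧ x ≤ s := by
    obtain ⟨s, hf, hs, hxs⟩ := exists_finite_isSharp_ge hArch hx
    obtain ⟨n, hn⟩ := isFiniteElement_iff.1 hf
    exact ⟨n, s, hn, hs, hxs⟩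
  obtain ⟨s, hn, hs, hxs⟩ := Nat.find_spec hex
  refine ⟨s, hn.isFiniteElement, ⟨hs, hxs⟩, fun b hb => ?_⟩
  obtain ⟨m, hm, hmb, he⟩ := hn.of_le (inf_le_left : s ⊓ b ≤ s)
  have hmin := Nat.find_min' hex ⟨s ⊓ b, hmb, hs.inf hb.1, le_inf hxs hb.2⟩
  exact inf_eq_left.1 (he (le_antisymm hm hmin))

/-- Take a sharp `t` whose remainder in `x` has the fewest atoms. Joining a sharp `b ≤ x` to `t`
cannot shorten the remainder, so `t ⊔ b = t`. -/
theorem exists_isGreatest_isSharp_le (hx : IsFiniteElement x) :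
    ∃ t, IsGreatest {b | IsSharp b ∧ b ≤ x} t := by
  classical
  have hex : ∃ n, ∃ t z, IsAtomSum n z ∧ oplus t z = some x ∧ IsSharp t := by
    obtain ⟨n, hn⟩ := isFiniteElement_iff.1 hx
    exact ⟨n, 0, x, hn, zero_oplus x, isSharp_zero⟩
  obtain ⟨t, z, hn, htz, ht⟩ := Nat.find_spec hex
  refine ⟨t, ⟨ht, z, htz⟩, fun b hb => ?_⟩
  obtain ⟨w, hw⟩ : t ⊔ b ≤ x := sup_le ⟨z, htz⟩ hb.2
  obtain ⟨m, hm, hmw, he⟩ := hn.of_le (sub_antitone htz hw le_sup_left)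
  have hmin := Nat.find_min' hex ⟨t ⊔ b, w, hmw, hw, ht.sup hb.1⟩
  obtain rfl := he (le_antisymm hm hmin)
  rw [oplus_comm] at htz hw
  exact sup_eq_left.1 (oplus_left_cancel hw htz)

variable (E) in
theorem isSubLatticeEffectAlgebra_finiteOrCofinite :
    LatticeEffectAlgebra.IsSubLatticeEffectAlgebra (finiteOrCofinite E) := by
  have hcompl : ∀ {x : E}, x ∈ finiteOrCofinite E → compl x ∈ finiteOrCofinite E := by
    rintro x (h | h)
    · exact Or.inr (by rwa [compl_compl])
    · exact Or.inl h
  have hsup : ∀ {x y : E}, x ∈ finiteOrCofinite E → y ∈ finiteOrCofinite E →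
      x ⊔ y ∈ finiteOrCofinite E := by
    rintro x y (hx | hx) (hy | hy)
    · exact Or.inl (hx.sup hy)
    · exact Or.inr (hy.of_le (compl_le_compl_iff.2 le_sup_right))
    · exact Or.inr (hx.of_le (compl_le_compl_iff.2 le_sup_left))
    · exact Or.inr (hx.of_le (compl_le_compl_iff.2 le_sup_left))
  have hzero : (0 : E) ∈ finiteOrCofinite E := Or.inl isFiniteElement_zero
  refine
    { zero_mem := hzero
      one_mem := ?_
      compl_mem := hcompl
      oplus_mem := ?_
      sup_mem := hsup
      inf_mem := ?_ }
  · rw [eq_compl (zero_oplus (1 : E))]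
    exact hcompl hzero
  · rintro x y z (hx | hx) (hy | hy) h
    · exact Or.inl (hx.oplus hy h)
    · exact Or.inr (hy.of_le (compl_le_compl_iff.2 (right_le_of_oplus h)))
    · exact Or.inr (hx.of_le (compl_le_compl_iff.2 (left_le_of_oplus h)))
    · exact Or.inr (hx.of_le (compl_le_compl_iff.2 (left_le_of_oplus h)))
  · intro x y hx hy
    have h := hcompl (hsup (hcompl hx) (hcompl hy))
    rwa [compl_sup, compl_compl, compl_compl] at h

end Modular

/-! ### Order and sharpness in a subalgebra -/

section Sub

theorem IsSubEffectAlgebra.coe_le_coe {E : Type*} [EffectAlgebra E] {Q : Set E}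
    (h : IsSubEffectAlgebra Q) {x y : Q} :
    letI := h.toEffectAlgebra
    (instPartialOrder (E := Q)).le x y ↔ (x : E) ≤ y := by
  constructor
  · rintro ⟨z, hz⟩
    exact ⟨z, h.subOplus_eq_some.1 hz⟩
  · rintro ⟨z, hz⟩
    -- The difference stays in `Q` because it equals `(x ⊕ y')'`.
    obtain ⟨w, hw, hw'⟩ := assoc_right ((oplus_comm _ _).trans hz) (oplus_compl (y : E))
    have hwQ : w ∈ Q := h.oplus_mem x.2 (h.compl_mem y.2) hw
    have hzQ : z ∈ Q := by
      rw [eq_compl ((oplus_comm _ _).trans hw')]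
      exact h.compl_mem hwQ
    exact ⟨⟨z, hzQ⟩, h.subOplus_eq_some.2 hz⟩

theorem IsSubEffectAlgebra.coe_compl {E : Type*} [EffectAlgebra E] {Q : Set E}
    (h : IsSubEffectAlgebra Q) (x : Q) :
    letI := h.toEffectAlgebra
    ((compl x : Q) : E) = compl (x : E) :=
  letI := h.toEffectAlgebra
  eq_compl (h.subOplus_eq_some.1 (oplus_compl x))

theorem _root_.LatticeEffectAlgebra.IsSubLatticeEffectAlgebra.isSharp_coe
    {E : Type*} [LatticeEffectAlgebra E] {Q : Set E}
    (h : LatticeEffectAlgebra.IsSubLatticeEffectAlgebra Q) {x : Q} :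
    letI := h.toIsSubEffectAlgebra.toEffectAlgebra
    IsSharp x ↔ IsSharp (x : E) := by
  let _ := h.toIsSubEffectAlgebra.toEffectAlgebra
  have hs := h.toIsSubEffectAlgebra
  change IsSharp x ↔ IsSharp (x : E)
  rw [isSharp_iff, isSharp_iff]
  constructor
  · intro hx c hc hc'
    -- The meet itself lies in `Q`, so testing sharpness inside `Q` already reaches it.
    have hm : (x : E) ⊓ compl (x : E) ∈ Q := h.inf_mem x.2 (h.compl_mem x.2)
    have h0 := hx ⟨_, hm⟩ (hs.coe_le_coe.2 inf_le_left)
      (hs.coe_le_coe.2 (by rw [hs.coe_compl]; exact inf_le_right))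
    have h0' : (x : E) ⊓ compl (x : E) = 0 := congrArg Subtype.val h0
    exact eq_zero_of_le_zero (h0' ▸ le_inf hc hc')
  · intro hx c hc hc'
    have hc'' := hs.coe_le_coe.1 hc'
    rw [hs.coe_compl] at hc''
    exact Subtype.ext (hx c (hs.coe_le_coe.1 hc) hc'')

end Sub

end EffectAlgebra

theorem mainTheorem10 {E : Type*} [LatticeEffectAlgebra E] [IsModularLattice E]
    (hArch : EffectAlgebra.IsArchimedean E) :
    ∃ h : LatticeEffectAlgebra.IsSubLatticeEffectAlgebra (EffectAlgebra.finiteOrCofinite E),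
      (∀ x : E, EffectAlgebra.IsFiniteElement x →
        (∃ s : E, IsLeast {b : E | EffectAlgebra.IsSharp b ∧ x ≤ b} s) ∧
        (∃ t : E, IsGreatest {b : E | EffectAlgebra.IsSharp b ∧ b ≤ x} t)) ∧
      @EffectAlgebra.IsSharplyDominating (EffectAlgebra.finiteOrCofinite E)
        h.toIsSubEffectAlgebra.toEffectAlgebra := by
  have h := EffectAlgebra.isSubLatticeEffectAlgebra_finiteOrCofinite E
  refine ⟨h, fun x hx => ⟨?_, EffectAlgebra.exists_isGreatest_isSharp_le hx⟩, ?_⟩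
  · obtain ⟨s, -, hs⟩ := EffectAlgebra.exists_isLeast_isSharp_ge hArch hx
    exact ⟨s, hs⟩
  · have hsub := h.toIsSubEffectAlgebra
    have key : ∀ a ∈ EffectAlgebra.finiteOrCofinite E, ∃ s ∈ EffectAlgebra.finiteOrCofinite E,
        IsLeast {b : E | EffectAlgebra.IsSharp b ∧ a ≤ b} s := by
      rintro a (ha | ha)
      · obtain ⟨s, hf, hs⟩ := EffectAlgebra.exists_isLeast_isSharp_ge hArch ha
        exact ⟨s, Or.inl hf, hs⟩
      -- Complementation reverses the order and preserves sharpness: the greatest sharp `t ≤ a'`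
      -- yields the least sharp `t' ≥ a`, and `t` is finite because `a'` is.
      · obtain ⟨t, ⟨hts, hta⟩, htg⟩ := EffectAlgebra.exists_isGreatest_isSharp_le ha
        refine ⟨EffectAlgebra.compl t, h.compl_mem (Or.inl (ha.of_le hta)),
          ⟨hts.isSharp_compl, EffectAlgebra.le_compl_comm.1 hta⟩, fun b hb => ?_⟩
        exact EffectAlgebra.compl_le_iff.1
          (htg ⟨hb.1.isSharp_compl, EffectAlgebra.compl_le_compl_iff.2 hb.2⟩)
    intro a
    obtain ⟨s, hsQ, ⟨hss, has⟩, hleast⟩ := key a a.2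
    refine ⟨⟨s, hsQ⟩, ⟨h.isSharp_coe.2 hss, hsub.coe_le_coe.2 has⟩, fun b hb => ?_⟩
    exact hsub.coe_le_coe.2 (hleast ⟨h.isSharp_coe.1 hb.1, hsub.coe_le_coe.1 hb.2⟩)
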